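/- Let $G$ be a second countable locally compact Hausdorff groupoid with unit space $G^0$, range and source maps $r,s$, and a Haar system $\{\lambda^u\}_{u\in G^0}$ (Radon measures on $G$ with $\operatorname{supp}\lambda^u=r^{-1}(u)$, with $u\mapsto\int f\,d\lambda^u$ continuous for every $f\in C_c(G)$, and with $\int f(\gamma\eta)\,d\lambda^{s(\gamma)}(\eta)=\int f(\eta)\,d\lambda^{r(\gamma)}(\eta)$ for all $\gamma\in G$ and $f\in C_c(G)$). For a finite Borel measure $\mu$ on $G^0$ let $\nu=\mu\circ\lambda$ be the Radon measure on $G$ with $\nu(f)=\int_{G^0}\int_G f(\gamma)\,d\lambda^u(\gamma)\,d\mu(u)$ for $f\in C_c(G)$, and let $\nu^{-1}$ be its image under inversion. Then for every $f\in C_c(G)$ there is a unique bounded operator $(\operatorname{Ind}\mu)(f)$ on $L^2(G,\nu^{-1})$ such that $$(\operatorname{Ind}\mu)(f)\xi(\gamma)=\int_G f(\eta)\,\xi(\eta^{-1}\gamma)\,d\lambda^{r(\gamma)}(\eta)\qquad\text{for all }\xi\in C_c(G)\text{ and }\nu^{-1}\text{-almost every }\gamma.$$ Let $\|f\|_r=\sup\{\|(\operatorname{Ind}\delta_u)(f)\|:u\in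 G^0\}$ be the reduced norm of $f$, where $\delta_u$ is the point mass at $u$. Then for all $f\in C_c(G)$, $$\|f\|_r=\sup\{\|(\operatorname{Ind}\mu)(f)\|:\mu\text{ is a finite Borel measure on }G^0\}<\infty.$$ -/

import Mathlib

open MeasureTheory
open scoped CompactlySupported ENNReal

/-- A topological groupoid with arrow space `G` and unit space `X` (the space `G⁰`).
The multiplication is only meaningful on composable pairs, i.e. pairs `(a, b)` with `s a = r b`;
all axioms, and the continuity of the multiplication, concern composable pairs only, and the value
of `mul` at other pairs is irrelevant. Since `r ∘ unit = id` with `r` and `unit` continuous, `unit`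
is a homeomorphism of `X` onto the set of units in `G` with the subspace topology. -/
structure TopologicalGroupoid (G X : Type*) [TopologicalSpace G] [TopologicalSpace X] where
  /-- range -/
  r : G → X
  /-- source -/
  s : G → X
  /-- inclusion of the unit space -/
  unit : X → G
  /-- (partial) multiplication -/
  mul : G → G → G
  /-- inversion -/
  inv : G → G
  r_unit : ∀ u, r (unit u) = u
  s_unit : ∀ u, s (unit u) = u
  r_mul : ∀ a b, s a = r b → r (mul a b) = r a
  s_mul : ∀ a b, s a = r b → s (mul a b) = s b
  mul_assoc : ∀ a b c, s a = r b → s b = r c → mul (mul a b) c = mul a (mul b c)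
  unit_mul : ∀ a, mul (unit (r a)) a = a
  mul_unit : ∀ a, mul a (unit (s a)) = a
  r_inv : ∀ a, r (inv a) = s a
  s_inv : ∀ a, s (inv a) = r a
  inv_mul : ∀ a, mul (inv a) a = unit (s a)
  mul_inv : ∀ a, mul a (inv a) = unit (r a)
  continuous_r : Continuous r
  continuous_s : Continuous s
  continuous_unit : Continuous unit
  continuous_inv : Continuous inv
  continuousOn_mul : ContinuousOn (fun p : G × G => mul p.1 p.2) {p | s p.1 = r p.2}

namespace TopologicalGroupoid

variable {G X : Type*} [TopologicalSpace G] [TopologicalSpace X]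

theorem inv_inv (𝒢 : TopologicalGroupoid G X) (a : G) : 𝒢.inv (𝒢.inv a) = a := by
  have h := 𝒢.mul_assoc (𝒢.inv (𝒢.inv a)) (𝒢.inv a) a (𝒢.s_inv _) (𝒢.s_inv _)
  have h2 := 𝒢.mul_unit (𝒢.inv (𝒢.inv a))
  rw [𝒢.inv_mul (𝒢.inv a), 𝒢.s_inv, 𝒢.unit_mul, 𝒢.inv_mul] at h
  rw [𝒢.s_inv, 𝒢.r_inv] at h2
  rw [← h2, ← h]

/-- Inversion as a homeomorphism. -/
def invHomeomorph (𝒢 : TopologicalGroupoid G X) : G ≃ₜ G where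
  toFun := 𝒢.inv
  invFun := 𝒢.inv
  left_inv := 𝒢.inv_inv
  right_inv := 𝒢.inv_inv
  continuous_toFun := 𝒢.continuous_inv
  continuous_invFun := 𝒢.continuous_inv

/-- A (left, continuous) Haar system `(λᵘ)`, indexed by the units `u`: each `λᵘ` is a Radon measure
on `G` with support exactly `Gᵘ = r⁻¹(u)`, `u ↦ ∫ f dλᵘ` is continuous for each `f ∈ C_c(G)`, and
`∫ f(γη) dλ^{s(γ)}(η) = ∫ f(η) dλ^{r(γ)}(η)` for all `f ∈ C_c(G)` and `γ ∈ G`. -/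
structure HaarSystem [MeasurableSpace G] [BorelSpace G] (𝒢 : TopologicalGroupoid G X) where
  measure : X → Measure G
  regular : ∀ u, (measure u).Regular
  support_eq : ∀ u, (measure u).support = 𝒢.r ⁻¹' {u}
  continuous_integral : ∀ f : C_c(G, ℂ), Continuous fun u => ∫ γ, f γ ∂(measure u)
  left_invariant : ∀ (γ : G) (f : C_c(G, ℂ)),
    ∫ η, f (𝒢.mul γ η) ∂(measure (𝒢.s γ)) = ∫ η, f η ∂(measure (𝒢.r γ))

namespace HaarSystem

variable [MeasurableSpace G] [BorelSpace G] {𝒢 : TopologicalGroupoid G X}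

theorem continuous_integral_real (haar : 𝒢.HaarSystem) (f : C_c(G, ℝ)) :
    Continuous fun u => ∫ γ, f γ ∂(haar.measure u) := by
  let F : C_c(G, ℂ) := f.compLeft ⟨Complex.ofReal, Complex.continuous_ofReal⟩
  have hF : ∀ γ, F γ = (f γ : ℂ) := fun γ =>
    CompactlySupportedContinuousMap.compLeft_apply (by simp) f γ
  have h := Complex.continuous_re.comp (haar.continuous_integral F)
  refine h.congr fun u => ?_
  simp only [Function.comp, hF, integral_complex_ofReal, Complex.ofReal_re]

theorem hasCompactSupport_integral [T2Space G] [LocallyCompactSpace G]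
    (haar : 𝒢.HaarSystem) (f : C_c(G, ℝ)) :
    HasCompactSupport fun u => ∫ γ, f γ ∂(haar.measure u) := by
  have : T2Space X := T2Space.of_injective_continuous
    (Function.LeftInverse.injective 𝒢.r_unit) 𝒢.continuous_unit
  have hK : IsCompact (𝒢.r '' tsupport f) := f.hasCompactSupport.image 𝒢.continuous_r
  refine HasCompactSupport.intro hK fun u hu => ?_
  have := haar.regular u
  refine integral_eq_zero_of_ae ?_
  filter_upwards [Measure.support_mem_ae_of_regular (μ := haar.measure u)] with γ hγ
  rw [haar.support_eq] at hγ
  by_contra h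
  exact hu ⟨γ, subset_tsupport _ h, hγ⟩

variable [T2Space G] [LocallyCompactSpace G] [MeasurableSpace X] [BorelSpace X]

theorem integrable_integral (haar : 𝒢.HaarSystem) (μ : Measure X) [IsFiniteMeasure μ]
    (f : C_c(G, ℝ)) : Integrable (fun u => ∫ γ, f γ ∂(haar.measure u)) μ :=
  (haar.continuous_integral_real f).integrable_of_hasCompactSupport
    (haar.hasCompactSupport_integral f)

/-- The positive linear functional `f ↦ ∫ ∫ f(γ) dλᵘ(γ) dμ(u)` on `C_c(G)`. -/
noncomputable def inducedFunctional (haar : 𝒢.HaarSystem) (μ : Measure X) [IsFiniteMeasure μ] :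
    C_c(G, ℝ) →ₚ[ℝ] ℝ :=
  PositiveLinearMap.mk₀
    { toFun := fun f => ∫ u, ∫ γ, f γ ∂(haar.measure u) ∂μ
      map_add' := fun f g => by
        rw [← integral_add (haar.integrable_integral μ f) (haar.integrable_integral μ g)]
        refine integral_congr_ae (Filter.Eventually.of_forall fun u => ?_)
        have := haar.regular u
        exact integral_add
          (f.continuous.integrable_of_hasCompactSupport f.hasCompactSupport)
          (g.continuous.integrable_of_hasCompactSupport g.hasCompactSupport)
      map_smul' := fun c f => by
        simp [integral_const_mul] }
    (fun f hf => integral_nonneg fun _ => integral_nonneg fun γ => hf γ)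

/-- The Radon measure `ν = μ ∘ λ` on `G`, given by `ν(f) = ∫ ∫ f(γ) dλᵘ(γ) dμ(u)` for
`f ∈ C_c(G)`. -/
noncomputable def inducedMeasure (haar : 𝒢.HaarSystem) (μ : Measure X) [IsFiniteMeasure μ] :
    Measure G :=
  RealRMK.rieszMeasure (haar.inducedFunctional μ)

theorem integral_inducedMeasure (haar : 𝒢.HaarSystem) (μ : Measure X) [IsFiniteMeasure μ]
    (f : C_c(G, ℝ)) :
    ∫ γ, f γ ∂(haar.inducedMeasure μ) = ∫ u, ∫ γ, f γ ∂(haar.measure u) ∂μ :=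
  RealRMK.integral_rieszMeasure (haar.inducedFunctional μ) f

instance regular_inducedMeasure (haar : 𝒢.HaarSystem) (μ : Measure X) [IsFiniteMeasure μ] :
    (haar.inducedMeasure μ).Regular :=
  inferInstanceAs (RealRMK.rieszMeasure (haar.inducedFunctional μ)).Regular

/-- The image `ν⁻¹` of `ν = μ ∘ λ` under inversion. -/
noncomputable def inducedMeasureInv (haar : 𝒢.HaarSystem) (μ : Measure X) [IsFiniteMeasure μ] :
    Measure G :=
  (haar.inducedMeasure μ).map 𝒢.inv

instance regular_inducedMeasureInv (haar : 𝒢.HaarSystem) (μ : Measure X) [IsFiniteMeasure μ] :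
    (haar.inducedMeasureInv μ).Regular :=
  Measure.Regular.map 𝒢.invHomeomorph

theorem memLp_inducedMeasureInv (haar : 𝒢.HaarSystem) (μ : Measure X) [IsFiniteMeasure μ]
    (ξ : C_c(G, ℂ)) : MemLp ξ 2 (haar.inducedMeasureInv μ) :=
  ξ.continuous.memLp_of_hasCompactSupport ξ.hasCompactSupport

/-- The convolution `(f * ξ)(γ) = ∫ f(η) ξ(η⁻¹γ) dλ^{r(γ)}(η)`. -/
noncomputable def conv (haar : 𝒢.HaarSystem) (f ξ : G → ℂ) (γ : G) : ℂ :=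
  ∫ η, f η * ξ (𝒢.mul (𝒢.inv η) γ) ∂(haar.measure (𝒢.r γ))

/-- `T` is the operator `(Ind μ)(f)`: a bounded operator on `L²(G, ν⁻¹)` with `T ξ = f * ξ` for all
`ξ ∈ C_c(G)`. -/
def IsInd (haar : 𝒢.HaarSystem) (μ : Measure X) [IsFiniteMeasure μ] (f : C_c(G, ℂ))
    (T : Lp ℂ 2 (haar.inducedMeasureInv μ) →L[ℂ] Lp ℂ 2 (haar.inducedMeasureInv μ)) : Prop :=
  ∀ ξ : C_c(G, ℂ),
    T ((haar.memLp_inducedMeasureInv μ ξ).toLp ξ) =ᵐ[haar.inducedMeasureInv μ] haar.conv f ξ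

open Classical in
/-- The operator `(Ind μ)(f)` on `L²(G, ν⁻¹)`: the bounded operator that extends `ξ ↦ f * ξ`,
`ξ ∈ C_c(G)` (and `0` if there were no such operator). -/
noncomputable def Ind (haar : 𝒢.HaarSystem) (μ : Measure X) [IsFiniteMeasure μ] (f : C_c(G, ℂ)) :
    Lp ℂ 2 (haar.inducedMeasureInv μ) →L[ℂ] Lp ℂ 2 (haar.inducedMeasureInv μ) :=
  if h : ∃ T, haar.IsInd μ f T then h.choose else 0

/-- The reduced norm `‖f‖_r = sup {‖(Ind δ_u)(f)‖ : u ∈ G⁰}`. -/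
noncomputable def reducedNorm (haar : 𝒢.HaarSystem) (f : C_c(G, ℂ)) : ℝ :=
  ⨆ u : X, ‖haar.Ind (Measure.dirac u) f‖

end HaarSystem

end TopologicalGroupoid

open Filter Topology

/-- A compactly supported version of the Tietze extension theorem: a function that is continuous
on a closed set and vanishes there off a compact set extends to an element of `C_c(Z)`. -/
theorem exists_compactlySupported_eqOn_of_isClosed {Z : Type*} [TopologicalSpace Z] [T2Space Z]
    [LocallyCompactSpace Z] [SecondCountableTopology Z] {A K : Set Z} (hA : IsClosed A)
    (hK : IsCompact K) {g : Z → ℂ} (hg : ContinuousOn g A) (hgK : ∀ z ∈ A, g z ≠ 0 → z ∈ K) :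
    ∃ F : C_c(Z, ℂ), Set.EqOn F g A := by
  obtain ⟨G₀, hG₀⟩ := ContinuousMap.exists_restrict_eq hA ⟨A.domRestrict g, hg.domRestrict⟩
  obtain ⟨χ, hχ1, -, hχ, -⟩ :=
    exists_continuous_one_zero_of_isCompact hK isClosed_empty (Set.disjoint_empty K)
  refine ⟨⟨⟨fun z => (χ z : ℂ) * G₀ z, by fun_prop⟩, ?_⟩, fun z hz => ?_⟩
  · exact (hχ.comp_left (g := Complex.ofReal) Complex.ofReal_zero).mul_right
  · have h : G₀ z = g z := DFunLike.congr_fun hG₀ ⟨z, hz⟩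
    change (χ z : ℂ) * G₀ z = g z
    rw [h]
    by_cases h0 : g z = 0
    · simp [h0]
    · simp [hχ1 (hgK z hz h0)]

/-- The Cauchy–Schwarz inequality for the measure with density `‖f‖`. -/
theorem sq_integral_norm_mul_norm_le {Z : Type*} [TopologicalSpace Z] [MeasurableSpace Z]
    [OpensMeasurableSpace Z] (μ : Measure Z) [IsFiniteMeasureOnCompacts μ] (f g : C_c(Z, ℂ)) :
    (∫ z, ‖f z‖ * ‖g z‖ ∂μ) ^ 2 ≤ (∫ z, ‖f z‖ ∂μ) * ∫ z, ‖f z‖ * ‖g z‖ ^ 2 ∂μ := by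
  have hf := f.continuous
  have hg := g.continuous
  have hint (k : ℕ) : Integrable (fun z => ‖f z‖ * ‖g z‖ ^ k) μ :=
    (show Continuous fun z => ‖f z‖ * ‖g z‖ ^ k by fun_prop).integrable_of_hasCompactSupport
      f.hasCompactSupport.norm.mul_right
  have h0 : Integrable (fun z => ‖f z‖) μ := by simpa using hint 0
  have h1 : Integrable (fun z => ‖f z‖ * ‖g z‖) μ := by simpa using hint 1
  have h2 := hint 2
  have key (t : ℝ) : 0 ≤ (∫ z, ‖f z‖ ∂μ) * (t * t) + (-2 * ∫ z, ‖f z‖ * ‖g z‖ ∂μ) * t +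
      ∫ z, ‖f z‖ * ‖g z‖ ^ 2 ∂μ := by
    have : 0 ≤ ∫ z, ‖f z‖ * (‖g z‖ - t) ^ 2 ∂μ := integral_nonneg fun z => by positivity
    have e : (fun z => ‖f z‖ * (‖g z‖ - t) ^ 2) =
        fun z => (t * t) * ‖f z‖ + (-2 * t) * (‖f z‖ * ‖g z‖) + ‖f z‖ * ‖g z‖ ^ 2 := by
      ext z; ring
    rw [e, integral_add (by exact (h0.const_mul _).add (h1.const_mul _)) h2,
      integral_add (h0.const_mul _) (h1.const_mul _), integral_const_mul, integral_const_mul] at this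
    linarith
  have := discrim_le_zero key
  rw [discrim] at this
  linarith

/-- Compactly supported continuous functions are dense in `Lᵖ`, `p < ∞`. -/
theorem denseRange_toLp_compactlySupported {Z : Type*} [TopologicalSpace Z] [T2Space Z]
    [LocallyCompactSpace Z] [SecondCountableTopology Z] [MeasurableSpace Z] [BorelSpace Z]
    (μ : Measure Z) [μ.Regular]
    {p : ℝ≥0∞} [Fact (1 ≤ p)] (hp : p ≠ ∞) (h : ∀ f : C_c(Z, ℂ), MemLp f p μ) :
    DenseRange fun f : C_c(Z, ℂ) => (h f).toLp f := by
  intro x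
  refine EMetric.mem_closure_iff.2 fun ε hε => ?_
  obtain ⟨δ, hδ, hδε⟩ := exists_between hε
  obtain ⟨g, hgK, hg, hgc, hgL⟩ :=
    (Lp.memLp x).exists_hasCompactSupport_eLpNorm_sub_le hp hδ.ne'
  refine ⟨_, ⟨⟨⟨g, hgc⟩, hgK⟩, rfl⟩, ?_⟩
  conv_lhs => rw [← Lp.toLp_coeFn x (Lp.memLp x)]
  rw [Lp.edist_toLp_toLp]
  exact hg.trans_lt hδε

theorem norm_toLp_two_sq {Z : Type*} [MeasurableSpace Z] {μ : Measure Z} {f : Z → ℂ}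
    (hf : MemLp f 2 μ) : ‖hf.toLp f‖ ^ 2 = ∫ z, ‖f z‖ ^ 2 ∂μ := by
  rw [Lp.norm_toLp, hf.eLpNorm_eq_integral_rpow_norm (by simp) (by simp),
    ENNReal.toReal_ofReal (by positivity), ← Real.rpow_natCast, ← Real.rpow_mul]
  · simp
  · exact integral_nonneg fun z => by positivity

namespace TopologicalGroupoid

variable {G X : Type*} [TopologicalSpace G] [TopologicalSpace X] (𝒢 : TopologicalGroupoid G X)

theorem inv_mul_cancel_left (a b : G) (h : 𝒢.r a = 𝒢.r b) :
    𝒢.mul a (𝒢.mul (𝒢.inv a) b) = b := by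
  rw [← 𝒢.mul_assoc _ _ _ (𝒢.r_inv a).symm (by rw [𝒢.s_inv, h]), 𝒢.mul_inv, h, 𝒢.unit_mul]

theorem mul_inv_cancel_left (a b : G) (h : 𝒢.s a = 𝒢.r b) :
    𝒢.mul (𝒢.inv a) (𝒢.mul a b) = b := by
  simpa [𝒢.inv_inv] using 𝒢.inv_mul_cancel_left (𝒢.inv a) b (by rw [𝒢.r_inv, h])

theorem inv_mul_rev (a b : G) (h : 𝒢.s a = 𝒢.r b) :
    𝒢.inv (𝒢.mul a b) = 𝒢.mul (𝒢.inv b) (𝒢.inv a) := by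
  have hc : 𝒢.r (𝒢.inv b) = 𝒢.s (𝒢.mul a b) := by rw [𝒢.r_inv, 𝒢.s_mul _ _ h]
  have hba : 𝒢.s (𝒢.inv b) = 𝒢.r (𝒢.inv a) := by rw [𝒢.s_inv, 𝒢.r_inv, h]
  have e : 𝒢.mul (𝒢.mul a b) (𝒢.mul (𝒢.inv b) (𝒢.inv a)) = 𝒢.unit (𝒢.r (𝒢.mul a b)) := by
    have h1 : 𝒢.mul b (𝒢.mul (𝒢.inv b) (𝒢.inv a)) = 𝒢.inv a :=
      𝒢.inv_mul_cancel_left b _ (by rw [𝒢.r_inv, h])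
    rw [𝒢.mul_assoc _ _ _ h (by rw [𝒢.r_mul _ _ hba, 𝒢.r_inv]), h1, 𝒢.mul_inv, 𝒢.r_mul _ _ h]
  have := 𝒢.mul_inv_cancel_left (𝒢.mul a b) (𝒢.mul (𝒢.inv b) (𝒢.inv a))
    (by rw [𝒢.r_mul _ _ hba, hc])
  rw [← this, e, ← 𝒢.s_inv, 𝒢.mul_unit]

theorem inv_mul_inv (a b : G) (h : 𝒢.r a = 𝒢.r b) :
    𝒢.inv (𝒢.mul (𝒢.inv a) b) = 𝒢.mul (𝒢.inv b) a := by
  rw [𝒢.inv_mul_rev _ _ (by rw [𝒢.s_inv, h]), 𝒢.inv_inv]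

theorem isClosed_fiberProduct [T2Space X] : IsClosed {p : G × G | 𝒢.r p.1 = 𝒢.r p.2} :=
  isClosed_eq (𝒢.continuous_r.comp continuous_fst) (𝒢.continuous_r.comp continuous_snd)

include 𝒢 in
theorem t2Space_units [T2Space G] : T2Space X :=
  T2Space.of_injective_continuous (Function.LeftInverse.injective 𝒢.r_unit) 𝒢.continuous_unit

theorem isCompact_mul [T2Space X] {K L : Set G} (hK : IsCompact K) (hL : IsCompact L) :
    IsCompact ((fun p : G × G => 𝒢.mul p.1 p.2) '' (K ×ˢ L ∩ {p | 𝒢.s p.1 = 𝒢.r p.2})) := by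
  refine ((hK.prod hL).inter_right ?_).image_of_continuousOn
    (𝒢.continuousOn_mul.mono Set.inter_subset_right)
  exact isClosed_eq (𝒢.continuous_s.comp continuous_fst) (𝒢.continuous_r.comp continuous_snd)

theorem continuousOn_inv_mul :
    ContinuousOn (fun p : G × G => 𝒢.mul (𝒢.inv p.2) p.1) {p | 𝒢.r p.1 = 𝒢.r p.2} := by
  refine 𝒢.continuousOn_mul.comp (f := fun p : G × G => (𝒢.inv p.2, p.1)) ?_ ?_
  · exact ((𝒢.continuous_inv.comp continuous_snd).prodMk continuous_fst).continuousOn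
  · intro p hp
    simpa [𝒢.s_inv] using hp.symm

variable [T2Space G] [LocallyCompactSpace G] [SecondCountableTopology G]

/-- The integrand of a convolution extends from the composable pairs to `C_c(G × G)`. -/
theorem exists_extension_conv_integrand (f ξ : C_c(G, ℂ)) :
    ∃ F : C_c(G × G, ℂ), ∀ γ η, 𝒢.r γ = 𝒢.r η → F (γ, η) = f η * ξ (𝒢.mul (𝒢.inv η) γ) := by
  have := 𝒢.t2Space_units
  suffices h : ∃ F : C_c(G × G, ℂ), Set.EqOn F
      (fun p : G × G => f p.2 * ξ (𝒢.mul (𝒢.inv p.2) p.1)) {p | 𝒢.r p.1 = 𝒢.r p.2} from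
    h.imp fun F hF γ η h => hF h
  refine exists_compactlySupported_eqOn_of_isClosed 𝒢.isClosed_fiberProduct
    ((𝒢.isCompact_mul f.hasCompactSupport ξ.hasCompactSupport).prod f.hasCompactSupport)
    ((f.continuous.comp continuous_snd).continuousOn.mul
      (ξ.continuous.comp_continuousOn 𝒢.continuousOn_inv_mul)) ?_
  rintro ⟨γ, η⟩ (h : 𝒢.r γ = 𝒢.r η) h0
  have h1 := subset_tsupport _ (left_ne_zero_of_mul h0)
  have h2 := subset_tsupport _ (right_ne_zero_of_mul h0)
  refine ⟨⟨(η, 𝒢.mul (𝒢.inv η) γ), ⟨⟨h1, h2⟩, ?_⟩, 𝒢.inv_mul_cancel_left _ _ h.symm⟩, h1⟩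
  simp [𝒢.r_mul (𝒢.inv η) γ (by rw [𝒢.s_inv, h]), 𝒢.r_inv]

/-- The reflected translate `η ↦ ξ(η⁻¹γ)` extends from the fiber of `r` to `C_c(G)`. -/
theorem exists_extension_translate (ξ : C_c(G, ℂ)) (γ : G) :
    ∃ g : C_c(G, ℂ), ∀ η, 𝒢.r η = 𝒢.r γ → g η = ξ (𝒢.mul (𝒢.inv η) γ) := by
  have := 𝒢.t2Space_units
  suffices h : ∃ F : C_c(G, ℂ), Set.EqOn F
      (fun η => ξ (𝒢.mul (𝒢.inv η) γ)) {η | 𝒢.r γ = 𝒢.r η} from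
    h.imp fun F hF η h => hF h.symm
  refine exists_compactlySupported_eqOn_of_isClosed (isClosed_eq continuous_const 𝒢.continuous_r)
    (𝒢.isCompact_mul (isCompact_singleton (x := γ))
      (ξ.hasCompactSupport.isCompact.image 𝒢.continuous_inv))
    (ξ.continuous.comp_continuousOn (𝒢.continuousOn_inv_mul.comp
      (f := fun η : G => (γ, η)) (by fun_prop) fun η hη => hη)) ?_
  intro η (h : 𝒢.r γ = 𝒢.r η) h0
  refine ⟨(γ, 𝒢.inv (𝒢.mul (𝒢.inv η) γ)), ⟨⟨rfl, _, subset_tsupport _ h0, rfl⟩, ?_⟩, ?_⟩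
  · simp [𝒢.r_inv, 𝒢.s_mul (𝒢.inv η) γ (by rw [𝒢.s_inv, h])]
  · simp only [𝒢.inv_mul_inv _ _ h.symm]
    exact 𝒢.inv_mul_cancel_left _ _ h

end TopologicalGroupoid

namespace TopologicalGroupoid.HaarSystem

variable {G X : Type*} [TopologicalSpace G] [TopologicalSpace X] {𝒢 : TopologicalGroupoid G X}
  [MeasurableSpace G] [BorelSpace G] (haar : 𝒢.HaarSystem)

theorem ae_r_eq [T2Space G] [LocallyCompactSpace G] (u : X) :
    ∀ᵐ γ ∂(haar.measure u), 𝒢.r γ = u := by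
  have := haar.regular u
  filter_upwards [Measure.support_mem_ae_of_regular (μ := haar.measure u)] with γ hγ
  rwa [haar.support_eq] at hγ

theorem exists_integral_norm_le [T2Space G] [LocallyCompactSpace G] (f : C_c(G, ℂ)) :
    ∃ C, 0 ≤ C ∧ ∀ u, ∫ γ, ‖f γ‖ ∂(haar.measure u) ≤ C := by
  let g : C_c(G, ℝ) := ⟨⟨fun γ => ‖f γ‖, f.continuous.norm⟩, f.hasCompactSupport.norm⟩
  obtain ⟨C, hC⟩ := (haar.hasCompactSupport_integral g).exists_bound_of_continuous
    (haar.continuous_integral_real g)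
  exact ⟨max C 0, le_max_right _ _,
    fun u => (le_abs_self _).trans ((hC u).trans (le_max_left _ _))⟩

variable [T2Space G] [LocallyCompactSpace G] [SecondCountableTopology G]

theorem continuous_integral_prod (F : C_c(G × G, ℂ)) :
    Continuous fun γ => ∫ η, F (γ, η) ∂(haar.measure (𝒢.r γ)) := by
  have hK : IsCompact (Prod.snd '' tsupport F) := F.hasCompactSupport.isCompact.image continuous_snd
  have hsec (γ : G) : HasCompactSupport fun η => F (γ, η) :=
    HasCompactSupport.intro hK fun η hη => by
      by_contra h
      exact hη ⟨(γ, η), subset_tsupport _ h, rfl⟩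
  have hcont (γ : G) : Continuous fun η => F (γ, η) := F.continuous.comp (by fun_prop)
  obtain ⟨χ, hχ1, -, hχ, hχI⟩ :=
    exists_continuous_one_zero_of_isCompact hK isClosed_empty (Set.disjoint_empty _)
  have hχc : Continuous fun γ => ∫ η, χ η ∂(haar.measure (𝒢.r γ)) :=
    (haar.continuous_integral_real ⟨χ, hχ⟩).comp 𝒢.continuous_r
  refine continuous_iff_continuousAt.2 fun γ₀ => ?_
  have h2 : Tendsto (fun γ => ∫ η, F (γ₀, η) ∂(haar.measure (𝒢.r γ))) (𝓝 γ₀)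
      (𝓝 (∫ η, F (γ₀, η) ∂(haar.measure (𝒢.r γ₀)))) :=
    ((haar.continuous_integral ⟨⟨_, hcont γ₀⟩, hsec γ₀⟩).comp 𝒢.continuous_r).tendsto γ₀
  have h1 : Tendsto (fun γ => ∫ η, F (γ, η) ∂(haar.measure (𝒢.r γ)) -
      ∫ η, F (γ₀, η) ∂(haar.measure (𝒢.r γ))) (𝓝 γ₀) (𝓝 0) := by
    rw [Metric.tendsto_nhds]
    intro ε hε
    set M := ∫ η, χ η ∂(haar.measure (𝒢.r γ₀)) + 1 with hM
    have hM0 : 0 < M := by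
      have : 0 ≤ ∫ η, χ η ∂(haar.measure (𝒢.r γ₀)) := integral_nonneg fun η => (hχI η).1
      linarith
    have hev : ∀ᶠ γ in 𝓝 γ₀, ∫ η, χ η ∂(haar.measure (𝒢.r γ)) < M :=
      hχc.continuousAt.eventually_lt continuousAt_const (by simp [hM])
    have hunif : ∀ᶠ γ in 𝓝 γ₀, ∀ η ∈ Prod.snd '' tsupport F,
        ‖F (γ, η) - F (γ₀, η)‖ < ε / M := by
      refine hK.eventually_forall_of_forall_eventually fun η _ => ?_
      have hc : Continuous fun p : G × G => ‖F (p.1, p.2) - F (γ₀, p.2)‖ :=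
        ((F.continuous.comp (by fun_prop)).sub (F.continuous.comp (by fun_prop))).norm
      exact hc.continuousAt.eventually_lt continuousAt_const (by simp; positivity)
    filter_upwards [hev, hunif] with γ hγ1 hγ2
    have := haar.regular (𝒢.r γ)
    have hle (η : G) : ‖F (γ, η) - F (γ₀, η)‖ ≤ ε / M * χ η := by
      by_cases hη : η ∈ Prod.snd '' tsupport F
      · simpa [hχ1 hη] using (hγ2 η hη).le
      · have hz (γ' : G) : F (γ', η) = 0 := by
          by_contra h
          exact hη ⟨(γ', η), subset_tsupport _ h, rfl⟩
        simp only [hz, sub_self, norm_zero]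
        exact mul_nonneg (by positivity) (hχI η).1
    rw [dist_zero_right, ← integral_sub ((hcont γ).integrable_of_hasCompactSupport (hsec γ))
      ((hcont γ₀).integrable_of_hasCompactSupport (hsec γ₀))]
    calc _ ≤ ∫ η, ε / M * χ η ∂(haar.measure (𝒢.r γ)) :=
          norm_integral_le_of_norm_le
            ((χ.continuous.integrable_of_hasCompactSupport hχ).const_mul _)
            (Eventually.of_forall hle)
      _ = ε / M * ∫ η, χ η ∂(haar.measure (𝒢.r γ)) := integral_const_mul _ _
      _ < ε / M * M := by gcongr
      _ = ε := by field_simp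
  have := h1.add h2
  simpa [ContinuousAt] using this

theorem exists_eq_conv (f ξ : C_c(G, ℂ)) : ∃ g : C_c(G, ℂ), ⇑g = haar.conv f ξ := by
  obtain ⟨F, hF⟩ := 𝒢.exists_extension_conv_integrand f ξ
  have e : haar.conv f ξ = fun γ => ∫ η, F (γ, η) ∂(haar.measure (𝒢.r γ)) := by
    ext γ
    refine integral_congr_ae ?_
    filter_upwards [haar.ae_r_eq (𝒢.r γ)] with η hη
    exact (hF γ η hη.symm).symm
  refine ⟨⟨⟨haar.conv f ξ, e ▸ haar.continuous_integral_prod F⟩, ?_⟩, rfl⟩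
  refine HasCompactSupport.intro (F.hasCompactSupport.isCompact.image continuous_fst) fun γ hγ => ?_
  change haar.conv f ξ γ = 0
  rw [e]
  refine integral_eq_zero_of_ae (Eventually.of_forall fun η => ?_)
  by_contra h
  exact hγ ⟨(γ, η), subset_tsupport _ h, rfl⟩

/-- The convolution of two elements of `C_c(G)` as an element of `C_c(G)`. -/
noncomputable def convC (f ξ : C_c(G, ℂ)) : C_c(G, ℂ) := (haar.exists_eq_conv f ξ).choose

@[simp]
theorem coe_convC (f ξ : C_c(G, ℂ)) : ⇑(haar.convC f ξ) = haar.conv f ξ :=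
  (haar.exists_eq_conv f ξ).choose_spec

/-- The function `γ ↦ f(γ⁻¹)` in `C_c(G)`. -/
noncomputable def _root_.TopologicalGroupoid.reflect (𝒢 : TopologicalGroupoid G X) (f : C_c(G, ℂ)) : C_c(G, ℂ) :=
  ⟨⟨fun γ => f (𝒢.inv γ), f.continuous.comp 𝒢.continuous_inv⟩,
    f.hasCompactSupport.comp_homeomorph 𝒢.invHomeomorph⟩

omit [MeasurableSpace G] [BorelSpace G] [T2Space G] [LocallyCompactSpace G]
  [SecondCountableTopology G] in
@[simp]
theorem _root_.TopologicalGroupoid.reflect_apply (f : C_c(G, ℂ)) (γ : G) :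
    𝒢.reflect f γ = f (𝒢.inv γ) := rfl

theorem integrable_translate (f ξ : C_c(G, ℂ)) (γ : G) :
    Integrable (fun η => f η * ξ (𝒢.mul (𝒢.inv η) γ)) (haar.measure (𝒢.r γ)) := by
  have := haar.regular (𝒢.r γ)
  obtain ⟨g, hg⟩ := 𝒢.exists_extension_translate ξ γ
  refine ((f * g).continuous.integrable_of_hasCompactSupport (f * g).hasCompactSupport).congr ?_
  filter_upwards [haar.ae_r_eq (𝒢.r γ)] with η hη
  simp [hg η hη]

theorem conv_inv (f ξ : C_c(G, ℂ)) (γ : G) :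
    haar.conv f ξ (𝒢.inv γ) = haar.conv (𝒢.reflect ξ) (𝒢.reflect f) γ := by
  obtain ⟨g, hg⟩ := 𝒢.exists_extension_translate ξ (𝒢.inv γ)
  have h := haar.left_invariant (𝒢.inv γ) (f * g)
  rw [𝒢.s_inv] at h
  have e1 : haar.conv f ξ (𝒢.inv γ) = ∫ η, (f * g) η ∂(haar.measure (𝒢.r (𝒢.inv γ))) := by
    refine integral_congr_ae ?_
    filter_upwards [haar.ae_r_eq _] with η hη
    simp [hg η hη]
  rw [e1, ← h]
  refine integral_congr_ae ?_
  filter_upwards [haar.ae_r_eq _] with η hη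
  have hc : 𝒢.s (𝒢.inv γ) = 𝒢.r η := by rw [𝒢.s_inv, hη]
  have h1 : 𝒢.mul (𝒢.inv (𝒢.mul (𝒢.inv γ) η)) (𝒢.inv γ) = 𝒢.inv η := by
    rw [𝒢.inv_mul_inv _ _ hη.symm, 𝒢.mul_assoc _ _ _ (by rw [𝒢.s_inv, hη]) (by rw [𝒢.r_inv]),
      𝒢.mul_inv, ← hη, ← 𝒢.s_inv, 𝒢.mul_unit]
  simp [hg _ (𝒢.r_mul _ _ hc), h1, 𝒢.inv_mul_inv _ _ hη, mul_comm]

theorem integral_conv (f k : C_c(G, ℂ)) (u : X) :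
    ∫ γ, haar.conv f k γ ∂(haar.measure u) =
      ∫ η, f η * ∫ γ, k γ ∂(haar.measure (𝒢.s η)) ∂(haar.measure u) := by
  have := haar.regular u
  obtain ⟨F, hF⟩ := 𝒢.exists_extension_conv_integrand f k
  calc _ = ∫ γ, ∫ η, F (γ, η) ∂(haar.measure u) ∂(haar.measure u) := by
        refine integral_congr_ae ?_
        filter_upwards [haar.ae_r_eq u] with γ hγ
        rw [conv, hγ]
        refine integral_congr_ae ?_
        filter_upwards [haar.ae_r_eq u] with η hη
        exact (hF γ η (hγ.trans hη.symm)).symm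
    _ = ∫ η, ∫ γ, F (γ, η) ∂(haar.measure u) ∂(haar.measure u) :=
        integral_integral_swap_of_hasCompactSupport (f := fun γ η => F (γ, η)) F.continuous F.hasCompactSupport
    _ = _ := by
        refine integral_congr_ae ?_
        filter_upwards [haar.ae_r_eq u] with η hη
        have h := haar.left_invariant (𝒢.inv η) k
        rw [𝒢.s_inv, 𝒢.r_inv, hη] at h
        rw [← h, ← integral_const_mul]
        refine integral_congr_ae ?_
        filter_upwards [haar.ae_r_eq u] with γ hγ
        exact hF γ η (hγ.trans hη.symm)

/-- The power `‖f‖ ^ (k + 1)` of the absolute value of `f`, as an element of `C_c(G, ℂ)`. -/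
noncomputable def normPow (f : C_c(G, ℂ)) (k : ℕ) : C_c(G, ℂ) :=
  ⟨⟨fun γ => ((‖f γ‖ ^ (k + 1) : ℝ) : ℂ), by have := f.continuous; fun_prop⟩,
    HasCompactSupport.comp_left (g := fun z : ℂ => ((‖z‖ ^ (k + 1) : ℝ) : ℂ)) f.hasCompactSupport
      (by simp)⟩

omit [MeasurableSpace G] [BorelSpace G] [T2Space G] [LocallyCompactSpace G]
  [SecondCountableTopology G] in
@[simp]
theorem normPow_apply (f : C_c(G, ℂ)) (k : ℕ) (γ : G) :
    normPow f k γ = ((‖f γ‖ ^ (k + 1) : ℝ) : ℂ) := rfl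

theorem norm_conv_sq_le (f ξ : C_c(G, ℂ)) (γ : G) {C : ℝ}
    (hC : ∀ u, ∫ γ, ‖f γ‖ ∂(haar.measure u) ≤ C) :
    ‖haar.conv f ξ γ‖ ^ 2 ≤ C * ‖haar.conv (normPow f 0) (normPow ξ 1) γ‖ := by
  have := haar.regular (𝒢.r γ)
  obtain ⟨g, hg⟩ := 𝒢.exists_extension_translate ξ γ
  have e : ‖haar.conv (normPow f 0) (normPow ξ 1) γ‖ =
      ∫ η, ‖f η‖ * ‖g η‖ ^ 2 ∂(haar.measure (𝒢.r γ)) := by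
    have : haar.conv (normPow f 0) (normPow ξ 1) γ =
        ((∫ η, ‖f η‖ * ‖g η‖ ^ 2 ∂(haar.measure (𝒢.r γ)) : ℝ) : ℂ) := by
      rw [← integral_complex_ofReal]
      refine integral_congr_ae ?_
      filter_upwards [haar.ae_r_eq _] with η hη
      simp [hg η hη]
    rw [this, Complex.norm_real, Real.norm_of_nonneg (integral_nonneg fun η => by positivity)]
  have e' : ‖haar.conv f ξ γ‖ ≤ ∫ η, ‖f η‖ * ‖g η‖ ∂(haar.measure (𝒢.r γ)) := by
    refine (norm_integral_le_integral_norm _).trans_eq (integral_congr_ae ?_)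
    filter_upwards [haar.ae_r_eq _] with η hη
    simp [hg η hη]
  calc _ ≤ (∫ η, ‖f η‖ * ‖g η‖ ∂(haar.measure (𝒢.r γ))) ^ 2 := by gcongr
    _ ≤ _ := sq_integral_norm_mul_norm_le _ f g
    _ ≤ _ := by
      rw [e]
      gcongr
      · exact hC _

/-- Schur's test: convolution by `f` is bounded on `L²(λ_u)`, uniformly in `u`. -/
theorem exists_integral_conv_inv_le (f : C_c(G, ℂ)) : ∃ C, 0 ≤ C ∧ ∀ (ξ : C_c(G, ℂ)) (u : X),
    ∫ γ, ‖haar.conv f ξ (𝒢.inv γ)‖ ^ 2 ∂(haar.measure u) ≤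
      C * ∫ γ, ‖ξ (𝒢.inv γ)‖ ^ 2 ∂(haar.measure u) := by
  obtain ⟨C, hC0, hC⟩ := haar.exists_integral_norm_le f
  obtain ⟨D, hD0, hD⟩ := haar.exists_integral_norm_le (𝒢.reflect (normPow f 0))
  refine ⟨C * D, by positivity, fun ξ u => ?_⟩
  have := haar.regular u
  set h := 𝒢.reflect (normPow ξ 1) with hh
  set k := 𝒢.reflect (normPow f 0) with hk
  have hint (g : C_c(G, ℂ)) (n : ℕ) (hn : n ≠ 0) :
      Integrable (fun γ => ‖g γ‖ ^ n) (haar.measure u) := by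
    have hg := g.continuous
    exact (show Continuous fun γ => ‖g γ‖ ^ n by fun_prop).integrable_of_hasCompactSupport
      (HasCompactSupport.comp_left (g := fun z : ℂ => ‖z‖ ^ n) g.hasCompactSupport (by simp [hn]))
  have hnonneg (γ : G) : ((‖haar.conv h k γ‖ : ℝ) : ℂ) = haar.conv h k γ := by
    have : haar.conv h k γ = ((∫ η, ‖ξ (𝒢.inv η)‖ ^ 2 * ‖f (𝒢.inv (𝒢.mul (𝒢.inv η) γ))‖
        ∂(haar.measure (𝒢.r γ)) : ℝ) : ℂ) := by
      rw [← integral_complex_ofReal]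
      simp [conv, hh, hk]
    rw [this, Complex.norm_real, Real.norm_of_nonneg (integral_nonneg fun η => by positivity)]
  calc ∫ γ, ‖haar.conv f ξ (𝒢.inv γ)‖ ^ 2 ∂(haar.measure u)
      ≤ ∫ γ, C * ‖haar.conv h k γ‖ ∂(haar.measure u) := by
        refine integral_mono ?_ ?_ fun γ => ?_
        · simpa using hint (𝒢.reflect (haar.convC f ξ)) 2 two_ne_zero
        · simpa using (hint (haar.convC h k) 1 one_ne_zero).const_mul C
        · rw [hh, hk, ← haar.conv_inv]
          exact haar.norm_conv_sq_le f ξ _ hC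
    _ = C * ‖∫ γ, haar.conv h k γ ∂(haar.measure u)‖ := by
        rw [integral_const_mul]
        congr 1
        have : ∫ γ, haar.conv h k γ ∂(haar.measure u) =
            ((∫ γ, ‖haar.conv h k γ‖ ∂(haar.measure u) : ℝ) : ℂ) := by
          rw [← integral_complex_ofReal]
          simp only [hnonneg]
        rw [this, Complex.norm_real,
          Real.norm_of_nonneg (integral_nonneg fun η => norm_nonneg _)]
    _ ≤ C * ∫ η, D * ‖ξ (𝒢.inv η)‖ ^ 2 ∂(haar.measure u) := by
        gcongr
        rw [haar.integral_conv]
        refine norm_integral_le_of_norm_le ((hint (𝒢.reflect ξ) 2 two_ne_zero).const_mul D)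
          (Eventually.of_forall fun η => ?_)
        have : ‖h η‖ = ‖ξ (𝒢.inv η)‖ ^ 2 := by simp [hh]
        rw [norm_mul, this, mul_comm]
        gcongr
        exact (norm_integral_le_integral_norm _).trans (hD _)
    _ = _ := by rw [integral_const_mul, _root_.mul_assoc]

end TopologicalGroupoid.HaarSystem

namespace TopologicalGroupoid.HaarSystem

variable {G X : Type*} [TopologicalSpace G] [TopologicalSpace X] {𝒢 : TopologicalGroupoid G X}
  [MeasurableSpace G] [BorelSpace G] [T2Space G] [LocallyCompactSpace G]
  [MeasurableSpace X] [BorelSpace X] (haar : 𝒢.HaarSystem)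

/-- The square of the `L²(λ_u)`-norm, where `λ_u` is the image of `λᵘ` under inversion. -/
noncomputable def fiberNormSq (g : C_c(G, ℂ)) (u : X) : ℝ :=
  ∫ γ, ‖g (𝒢.inv γ)‖ ^ 2 ∂(haar.measure u)

omit [MeasurableSpace G] [BorelSpace G] [T2Space G] [LocallyCompactSpace G]
  [MeasurableSpace X] [BorelSpace X] in
theorem exists_real_normSq_reflect (g : C_c(G, ℂ)) :
    ∃ h : C_c(G, ℝ), ∀ γ, h γ = ‖g (𝒢.inv γ)‖ ^ 2 := by
  have hg := (𝒢.reflect g).continuous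
  exact ⟨⟨⟨fun γ => ‖𝒢.reflect g γ‖ ^ 2, by fun_prop⟩,
    HasCompactSupport.comp_left (g := fun z : ℂ => ‖z‖ ^ 2) (𝒢.reflect g).hasCompactSupport
      (by simp)⟩, fun γ => rfl⟩

theorem integrable_fiberNormSq (μ : Measure X) [IsFiniteMeasure μ] (g : C_c(G, ℂ)) :
    Integrable (haar.fiberNormSq g) μ := by
  obtain ⟨h, hh⟩ := exists_real_normSq_reflect (𝒢 := 𝒢) g
  refine (haar.integrable_integral μ h).congr (Eventually.of_forall fun u => ?_)
  simp only [hh, fiberNormSq]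

theorem integral_normSq_inducedMeasureInv (μ : Measure X) [IsFiniteMeasure μ] (g : C_c(G, ℂ)) :
    ∫ γ, ‖g γ‖ ^ 2 ∂(haar.inducedMeasureInv μ) = ∫ u, haar.fiberNormSq g u ∂μ := by
  obtain ⟨h, hh⟩ := exists_real_normSq_reflect (𝒢 := 𝒢) g
  have := haar.integral_inducedMeasure μ h
  simp only [hh] at this
  have hm : MeasurableEmbedding 𝒢.inv := 𝒢.invHomeomorph.measurableEmbedding
  rw [inducedMeasureInv, hm.integral_map, this]
  rfl

/-- The inclusion of `C_c(G)` in `L²(G, ν⁻¹)`. -/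
noncomputable def toL2 (μ : Measure X) [IsFiniteMeasure μ] :
    C_c(G, ℂ) →ₗ[ℂ] Lp ℂ 2 (haar.inducedMeasureInv μ) where
  toFun ξ := (haar.memLp_inducedMeasureInv μ ξ).toLp ξ
  map_add' ξ ζ := MemLp.toLp_add (haar.memLp_inducedMeasureInv μ ξ)
    (haar.memLp_inducedMeasureInv μ ζ)
  map_smul' c ξ := MemLp.toLp_const_smul c (haar.memLp_inducedMeasureInv μ ξ)

theorem norm_toL2_sq (μ : Measure X) [IsFiniteMeasure μ] (ξ : C_c(G, ℂ)) :
    ‖haar.toL2 μ ξ‖ ^ 2 = ∫ u, haar.fiberNormSq ξ u ∂μ :=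
  (norm_toLp_two_sq (haar.memLp_inducedMeasureInv μ ξ)).trans (haar.integral_normSq_inducedMeasureInv μ ξ)

variable [SecondCountableTopology G]

theorem denseRange_toL2 (μ : Measure X) [IsFiniteMeasure μ] : DenseRange (haar.toL2 μ) :=
  denseRange_toLp_compactlySupported _ (by simp) (haar.memLp_inducedMeasureInv μ)

omit [MeasurableSpace X] [BorelSpace X] in
theorem convC_add (f ξ ζ : C_c(G, ℂ)) :
    haar.convC f (ξ + ζ) = haar.convC f ξ + haar.convC f ζ := by
  ext γ
  simp only [CompactlySupportedContinuousMap.coe_add, coe_convC, Pi.add_apply, conv, mul_add]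
  exact integral_add (haar.integrable_translate f ξ γ) (haar.integrable_translate f ζ γ)

omit [MeasurableSpace X] [BorelSpace X] in
theorem convC_smul (f : C_c(G, ℂ)) (c : ℂ) (ξ : C_c(G, ℂ)) :
    haar.convC f (c • ξ) = c • haar.convC f ξ := by
  ext γ
  simp only [CompactlySupportedContinuousMap.coe_smul, coe_convC, Pi.smul_apply, conv,
    smul_eq_mul, mul_left_comm _ c]
  exact integral_const_mul _ _

/-- Convolution by `f` on `C_c(G)`, with values in `L²(G, ν⁻¹)`. -/
noncomputable def convL2 (μ : Measure X) [IsFiniteMeasure μ] (f : C_c(G, ℂ)) :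
    C_c(G, ℂ) →ₗ[ℂ] Lp ℂ 2 (haar.inducedMeasureInv μ) :=
  haar.toL2 μ ∘ₗ
    { toFun := haar.convC f
      map_add' := haar.convC_add f
      map_smul' := haar.convC_smul f }

theorem convL2_apply (μ : Measure X) [IsFiniteMeasure μ] (f ξ : C_c(G, ℂ)) :
    haar.convL2 μ f ξ = haar.toL2 μ (haar.convC f ξ) := rfl

theorem isInd_iff {μ : Measure X} [IsFiniteMeasure μ] {f : C_c(G, ℂ)}
    {T : Lp ℂ 2 (haar.inducedMeasureInv μ) →L[ℂ] Lp ℂ 2 (haar.inducedMeasureInv μ)} :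
    haar.IsInd μ f T ↔ ∀ ξ, T (haar.toL2 μ ξ) = haar.convL2 μ f ξ := by
  refine forall_congr' fun ξ => ?_
  have h : haar.convL2 μ f ξ =ᵐ[haar.inducedMeasureInv μ] haar.conv f ξ := by
    rw [← haar.coe_convC]
    exact MemLp.coeFn_toLp (haar.memLp_inducedMeasureInv μ (haar.convC f ξ))
  constructor
  · intro hT
    exact Lp.ext (EventuallyEq.trans hT h.symm)
  · intro hT
    change T (haar.toL2 μ ξ) =ᵐ[haar.inducedMeasureInv μ] haar.conv f ξ
    rw [hT]
    exact h

/-- A bound for convolution by `f` on the fibers `L²(λ_u)` bounds it on `L²(G, ν⁻¹)`. -/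
theorem norm_convL2_le (μ : Measure X) [IsFiniteMeasure μ] {f ξ : C_c(G, ℂ)} {C : ℝ} (hC : 0 ≤ C)
    (h : ∀ u, haar.fiberNormSq (haar.convC f ξ) u ≤ C ^ 2 * haar.fiberNormSq ξ u) :
    ‖haar.convL2 μ f ξ‖ ≤ C * ‖haar.toL2 μ ξ‖ := by
  refine le_of_sq_le_sq ?_ (by positivity)
  rw [convL2_apply, mul_pow, norm_toL2_sq, norm_toL2_sq, ← integral_const_mul]
  exact integral_mono (haar.integrable_fiberNormSq μ _)
    ((haar.integrable_fiberNormSq μ _).const_mul _) h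

/-- The operators `(Ind μ)(f)` are bounded, uniformly in `μ`. -/
theorem exists_norm_convL2_le (f : C_c(G, ℂ)) : ∃ C, 0 ≤ C ∧
    ∀ (μ : Measure X) [IsFiniteMeasure μ] ξ, ‖haar.convL2 μ f ξ‖ ≤ C * ‖haar.toL2 μ ξ‖ := by
  obtain ⟨C, hC0, hC⟩ := haar.exists_integral_conv_inv_le f
  refine ⟨√C, by positivity, fun μ _ ξ => haar.norm_convL2_le μ (by positivity) fun u => ?_⟩
  rw [Real.sq_sqrt hC0]
  simpa [fiberNormSq] using hC ξ u

theorem existsUnique_isInd (μ : Measure X) [IsFiniteMeasure μ] (f : C_c(G, ℂ)) :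
    ∃! T, haar.IsInd μ f T := by
  obtain ⟨C, -, hC⟩ := haar.exists_norm_convL2_le f
  simp only [isInd_iff]
  refine ⟨(haar.convL2 μ f).extendOfNorm (haar.toL2 μ),
    fun ξ => LinearMap.extendOfNorm_eq (haar.denseRange_toL2 μ) ⟨C, hC μ⟩ ξ, fun S hS => ?_⟩
  exact (LinearMap.extendOfNorm_unique (haar.denseRange_toL2 μ) C (hC μ) S
    (LinearMap.ext hS)).symm

theorem Ind_toL2 (μ : Measure X) [IsFiniteMeasure μ] (f ξ : C_c(G, ℂ)) :
    haar.Ind μ f (haar.toL2 μ ξ) = haar.convL2 μ f ξ := by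
  have h := (haar.existsUnique_isInd μ f).exists
  rw [Ind, dif_pos h]
  exact haar.isInd_iff.1 h.choose_spec ξ

theorem norm_Ind_le (μ : Measure X) [IsFiniteMeasure μ] {f : C_c(G, ℂ)} {C : ℝ} (hC : 0 ≤ C)
    (h : ∀ ξ, ‖haar.convL2 μ f ξ‖ ≤ C * ‖haar.toL2 μ ξ‖) : ‖haar.Ind μ f‖ ≤ C :=
  ContinuousLinearMap.opNorm_le_bound _ hC fun x =>
    (haar.denseRange_toL2 μ).induction_on x (isClosed_le (by fun_prop) (by fun_prop))
      fun ξ => by rw [haar.Ind_toL2]; exact h ξ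

theorem exists_norm_Ind_le (f : C_c(G, ℂ)) :
    ∃ C, ∀ (μ : Measure X) [IsFiniteMeasure μ], ‖haar.Ind μ f‖ ≤ C := by
  obtain ⟨C, hC0, hC⟩ := haar.exists_norm_convL2_le f
  exact ⟨C, fun μ _ => haar.norm_Ind_le μ hC0 (hC μ)⟩

theorem bddAbove_norm_Ind_dirac (f : C_c(G, ℂ)) :
    BddAbove (Set.range fun u : X => ‖haar.Ind (Measure.dirac u) f‖) := by
  obtain ⟨C, hC⟩ := haar.exists_norm_Ind_le f
  exact ⟨C, Set.forall_mem_range.2 fun u => hC _⟩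

theorem fiberNormSq_convC_le (f ξ : C_c(G, ℂ)) (u : X) :
    haar.fiberNormSq (haar.convC f ξ) u ≤ haar.reducedNorm f ^ 2 * haar.fiberNormSq ξ u := by
  have := 𝒢.t2Space_units
  have h (g : C_c(G, ℂ)) : haar.fiberNormSq g u = ‖haar.toL2 (Measure.dirac u) g‖ ^ 2 := by
    rw [norm_toL2_sq, integral_dirac]
  rw [h, h, ← mul_pow, ← convL2_apply, ← haar.Ind_toL2]
  gcongr
  refine (ContinuousLinearMap.le_opNorm _ _).trans ?_
  gcongr
  exact le_ciSup (haar.bddAbove_norm_Ind_dirac f) u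

theorem norm_Ind_le_reducedNorm (μ : Measure X) [IsFiniteMeasure μ] (f : C_c(G, ℂ)) :
    ‖haar.Ind μ f‖ ≤ haar.reducedNorm f := by
  have h0 : 0 ≤ haar.reducedNorm f := Real.iSup_nonneg fun u => norm_nonneg _
  exact haar.norm_Ind_le μ h0 fun ξ => haar.norm_convL2_le μ h0 (haar.fiberNormSq_convC_le f ξ)

end TopologicalGroupoid.HaarSystem

theorem corollary3 {G X : Type*} [TopologicalSpace G] [T2Space G] [LocallyCompactSpace G]
    [SecondCountableTopology G] [MeasurableSpace G] [BorelSpace G]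
    [TopologicalSpace X] [MeasurableSpace X] [BorelSpace X]
    (𝒢 : TopologicalGroupoid G X) (haar : 𝒢.HaarSystem) :
    (∀ (μ : FiniteMeasure X) (f : C_c(G, ℂ)), ∃! T, haar.IsInd (μ : Measure X) f T) ∧
    ∀ f : C_c(G, ℂ),
      BddAbove (Set.range fun μ : FiniteMeasure X => ‖haar.Ind (μ : Measure X) f‖) ∧
      haar.reducedNorm f = ⨆ μ : FiniteMeasure X, ‖haar.Ind (μ : Measure X) f‖ := by
  refine ⟨fun μ f => haar.existsUnique_isInd μ f, fun f => ?_⟩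
  have hle (μ : FiniteMeasure X) : ‖haar.Ind (μ : Measure X) f‖ ≤ haar.reducedNorm f :=
    haar.norm_Ind_le_reducedNorm μ f
  have hbdd : BddAbove (Set.range fun μ : FiniteMeasure X => ‖haar.Ind (μ : Measure X) f‖) :=
    ⟨_, Set.forall_mem_range.2 hle⟩
  refine ⟨hbdd, le_antisymm (Real.iSup_le (fun u => ?_) ?_) (ciSup_le hle)⟩
  · exact le_ciSup hbdd (⟨Measure.dirac u, inferInstance⟩ : FiniteMeasure X)
  · exact Real.iSup_nonneg fun μ => norm_nonneg _
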